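/- Let $d\ge 1$, let $a>1$, let $G\le O_d(\mathbb R)$ be a finite subgroup with $-I\in G$, and let $J\in\mathbb Z$. Let $\psi,\phi\in L^1(\mathbb R^d)\cap L^2(\mathbb R^d)$ be admissible for $(a,G)$-wavelet scattering, i.e. $$|\widehat\phi(\xi)|^2+\sum_{j=1}^\infty\sum_{M\in G}|\widehat\psi(a^{-j}M^{-1}\xi)|^2=1\quad\text{for a.e. }\xi\in\mathbb R^d ,\qquad \widehat f(\xi)=\int_{\mathbb R^d}f(x)e^{-2\pi i\langle x,\xi\rangle}\,dx .$$ Put $\Lambda=\{a^jM : j\in\mathbb Z,\ j>-J,\ M\in G\}$ and $\psi_\lambda(x)=|\det\lambda|\,\psi(\lambda^{T}x)$ for $\lambda\in\Lambda$, and let $\mathrm{Wav}(\psi,a,G,J)=(\psi_\lambda)_{\lambda\in\Lambda}$ be the resulting family of wavelet-generated filters (indexed by $\Lambda$, so that filters that happen to coincide are counted with multiplicity). For $f\in L^2(\mathbb R^d)$ (complex-valued) and $N\in\mathbb N=\{1,2,\dots\}$ let $$W_N(f)=\sum_{(\lambda_1,\dots,\lambda_N)\in\Lambda^N}\Big\|\,\big|\cdots\big||f*\psi_{\lambda_1}|*\psi_{\lambda_2}\big|\cdots*\psi_{\lambda_N}\big|\,\Big\|_2^2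 .$$ Then for every $g\in L^2(\mathbb R^d)$ there is a constant $C_g>0$ such that for every nonincreasing sequence $E=(E_N)_{N\in\mathbb N}$ of positive reals with $E_N\to0$ there exists $f_{g,E}\in L^2(\mathbb R^d)$ with a) $\|f_{g,E}\|_2^2\le C_g\,(1+E_1)$, b) $\|f_{g,E}-g\|_2^2\le C_g\,E_1$, and c) $W_N(f_{g,E})\ge \frac{\|g\|_2^2}{8}\,E_N$ for all $N\in\mathbb N$. Furthermore, for every such sequence $E$, the set $$Y_E=\{f\in L^2(\mathbb R^d) : \exists\, C>0,\ N_0\in\mathbb N\ \ \forall N\ge N_0:\ W_N(f)\le C\,E_N\}$$ is meagre in $L^2(\mathbb R^d)$ (a countable union of nowhere dense sets), and its complement $L^2(\mathbb R^d)\setminus Y_E$ is dense in $L^2(\mathbb R^d)$. -/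

import Mathlib

open MeasureTheory Filter Topology
open scoped FourierTransform ENNReal

noncomputable section

namespace Scattering

/-- The space `L²(ℝᵈ)` of complex-valued functions, with Lebesgue measure. -/
abbrev L2 (d : ℕ) : Type :=
  Lp ℂ 2 (volume : Measure (EuclideanSpace ℝ (Fin d)))

/-- The single step scattering propagator `U[ψ] f = |f * ψ|`. For `f ∈ L²` and `ψ ∈ L¹ ∩ L²` the
convolution integral converges absolutely at every point, and it depends only on the almost
everywhere class of `f`. -/
def step {d : ℕ} (f ψ : EuclideanSpace ℝ (Fin d) → ℂ) : EuclideanSpace ℝ (Fin d) → ℂ :=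
  fun x => ((‖convolution f ψ (ContinuousLinearMap.mul ℂ ℂ) volume x‖ : ℝ) : ℂ)

/-- The scattering propagator along the path `(ψ₁, …, ψ_N)`:
`U[p] f = | … |f * ψ₁| * … * ψ_N|`, and `U[e] f = f` for the empty path. -/
def propagator {d : ℕ} (p : List (EuclideanSpace ℝ (Fin d) → ℂ))
    (f : EuclideanSpace ℝ (Fin d) → ℂ) : EuclideanSpace ℝ (Fin d) → ℂ :=
  p.foldl step f

/-- The energy remainder `W_N[Ψ](f) = ∑_{p ∈ Ψ^N} ‖U[p] f‖₂²` of a family of filters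
`Ψ = (Ψ i)_{i ∈ ι}`, as an extended nonnegative real. -/
def energyRemainder {d : ℕ} {ι : Type*} (Ψ : ι → EuclideanSpace ℝ (Fin d) → ℂ) (N : ℕ)
    (f : EuclideanSpace ℝ (Fin d) → ℂ) : ℝ≥0∞ :=
  ∑' p : Fin N → ι,
    eLpNorm (propagator (List.ofFn fun n => Ψ (p n)) f) 2 volume ^ 2

/-- The `L¹`-normalized dilation `D¹_A f = |det A| f(A ·)`. -/
def dilation {d : ℕ} (A : Matrix (Fin d) (Fin d) ℝ) (f : EuclideanSpace ℝ (Fin d) → ℂ) :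
    EuclideanSpace ℝ (Fin d) → ℂ :=
  fun x => ((|A.det| : ℝ) : ℂ) * f (Matrix.toEuclideanLin A x)

/-- A pair `(ψ, φ)` of functions in `L¹ ∩ L²` is admissible for `(a, G)`-wavelet scattering if
`|φ̂(ξ)|² + ∑_{j ≥ 1} ∑_{M ∈ G} |ψ̂(a⁻ʲ M⁻¹ ξ)|² = 1` for almost every `ξ`
(the sum over `j ≥ 1` is written as a sum over `j + 1` with `j ≥ 0`). -/
structure Admissible {d : ℕ} (a : ℝ) (G : Subgroup (Matrix.orthogonalGroup (Fin d) ℝ))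
    (ψ φ : EuclideanSpace ℝ (Fin d) → ℂ) : Prop where
  memLp_one_psi : MemLp ψ 1 volume
  memLp_two_psi : MemLp ψ 2 volume
  memLp_one_phi : MemLp φ 1 volume
  memLp_two_phi : MemLp φ 2 volume
  littlewoodPaley : ∀ᵐ ξ : EuclideanSpace ℝ (Fin d),
    ‖𝓕 φ ξ‖ₑ ^ 2 + ∑' j : ℕ, ∑' M : G,
      ‖𝓕 ψ ((a ^ (j + 1))⁻¹ •
        Matrix.toEuclideanLin ((M : Matrix.orthogonalGroup (Fin d) ℝ)⁻¹).1 ξ)‖ₑ ^ 2 = 1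

/-- The index set `Λ(a, G, J) = {aʲ M | j ∈ ℤ, j > -J, M ∈ G}`. -/
def Lam {d : ℕ} (a : ℝ) (G : Subgroup (Matrix.orthogonalGroup (Fin d) ℝ)) (J : ℤ) :
    Set (Matrix (Fin d) (Fin d) ℝ) :=
  {A | ∃ j : ℤ, -J < j ∧ ∃ M ∈ G, A = a ^ j • M.1}

/-- The family of filters `Wav(ψ, a, G, J) = (ψ_λ)_{λ ∈ Λ(a, G, J)}`, where `ψ_λ = D¹_{λᵀ} ψ`. -/
def Wav {d : ℕ} (ψ : EuclideanSpace ℝ (Fin d) → ℂ) (a : ℝ)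
    (G : Subgroup (Matrix.orthogonalGroup (Fin d) ℝ)) (J : ℤ) :
    Lam a G J → EuclideanSpace ℝ (Fin d) → ℂ :=
  fun l => dilation l.1.transpose ψ

/-- `E = (E_N)_{N ≥ 1}` is a nonincreasing null sequence of positive reals
(the value `E 0` plays no role). -/
structure IsNullSeq (E : ℕ → ℝ) : Prop where
  pos : ∀ N, 1 ≤ N → 0 < E N
  anti : ∀ M N, 1 ≤ M → M ≤ N → E N ≤ E M
  lim : Tendsto E atTop (𝓝 0)

/-- The set `Y_E` of all `f ∈ L²(ℝᵈ)` with `W_N[Ψ](f) ∈ O(E_N)`. -/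
def fastDecay {d : ℕ} {ι : Type*} (Ψ : ι → EuclideanSpace ℝ (Fin d) → ℂ) (E : ℕ → ℝ) :
    Set (L2 d) :=
  {f | ∃ C : ℝ, 0 < C ∧ ∃ N₀ : ℕ, 1 ≤ N₀ ∧ ∀ N, N₀ ≤ N →
    energyRemainder Ψ N f ≤ ENNReal.ofReal (C * E N)}

end Scattering

end

/-! Dilating the Littlewood–Paley identity by `a ^ n` and letting `n → ∞` removes the low-pass term
(Riemann–Lebesgue), so the wavelets at all scales form a tight family (`Admissible.tsum_fullWav`).
For that family every layer carries the whole energy of the signal, and finitely many paths of a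
given length already carry more than half of it. Shrinking the signal by `a ^ k` shifts these paths
up by `k` scales, eventually into the scales above `-J`, at no cost in norm. A fixed background `h`
has vanishing response to ever finer filters. Hence any `h` can be perturbed by a bump of prescribed
norm that is still visible at a prescribed depth (`Admissible.exists_rescale`). A gliding hump
argument (`exists_slow_decay`) adds such bumps to `g`, with geometrically decaying norms and
increasing depths; stability of the layers keeps later bumps from destroying earlier ones. Since
slow decay thus occurs arbitrarily close to any `g`, the sets with a uniform decay bound are nowhere
dense (`isNowhereDense_fast_decay`), and Baire's theorem gives the rest. -/

namespace Scattering

/-! ### Plancherel theory for convolution of an `L²` function with an `L¹ ∩ L²` filter -/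

section Fourier

variable {V : Type*} [NormedAddCommGroup V] [InnerProductSpace ℝ V] [FiniteDimensional ℝ V]
  [MeasurableSpace V] [BorelSpace V]

theorem continuous_fourier_of_integrable {f : V → ℂ} (hf : Integrable f) : Continuous (𝓕 f) :=
  VectorFourier.fourierIntegral_continuous Real.continuous_fourierChar
    (L := innerₗ V) continuous_inner hf

theorem norm_fourier_le (f : V → ℂ) (ξ : V) : ‖𝓕 f ξ‖ ≤ ∫ x, ‖f x‖ :=
  VectorFourier.norm_fourierIntegral_le_integral_norm _ _ (innerₗ V) f ξ

theorem integral_fourier_mul_eq {f g : V → ℂ} (hf : Integrable f) (hg : Integrable g) :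
    ∫ ξ, 𝓕 f ξ * g ξ = ∫ x, f x * 𝓕 g x := by
  have h := VectorFourier.integral_fourierIntegral_smul_eq_flip (μ := (volume : Measure V))
    (ν := (volume : Measure V)) (L := innerₗ V) Real.continuous_fourierChar continuous_inner hf hg
  rw [flip_innerₗ] at h
  exact h

/-- On `L¹ ∩ L²` the Fourier integral agrees with the Fourier transform on `L²`. -/
theorem coeFn_fourier_toLp {f : V → ℂ} (h1 : MemLp f 1) (h2 : MemLp f 2) :
    (𝓕 (h2.toLp f) : Lp ℂ 2 (volume : Measure V)) =ᵐ[volume] 𝓕 f := by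
  -- Both sides are locally integrable, so it suffices to test against smooth compactly supported
  -- functions; these are Schwartz, and the distributional transform moves onto them.
  have hf : Integrable f := memLp_one_iff_integrable.1 h1
  refine ae_eq_of_integral_contDiff_smul_eq
    ((Lp.memLp _).locallyIntegrable one_le_two)
    (continuous_fourier_of_integrable hf).locallyIntegrable ?_
  intro g g_smooth g_cpt
  have hg₁ : HasCompactSupport (Complex.ofRealCLM ∘ g) := g_cpt.comp_left rfl
  have hg₂ : ContDiff ℝ (⊤ : ℕ∞) (Complex.ofRealCLM ∘ g) := by fun_prop
  set G := hg₁.toSchwartzMap hg₂ with hG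
  have hGg : ∀ x, G x = (g x : ℂ) := fun x => by simp [G]
  calc ∫ x, g x • (𝓕 (h2.toLp f) : Lp ℂ 2 (volume : Measure V)) x
      = Lp.toTemperedDistribution (𝓕 (h2.toLp f) : Lp ℂ 2 (volume : Measure V)) G := by
        rw [Lp.toTemperedDistribution_apply]; simp [hGg]
    _ = ∫ x, 𝓕 G x • h2.toLp f x := by
        rw [← Lp.fourier_toTemperedDistribution_eq, TemperedDistribution.fourier_apply,
          Lp.toTemperedDistribution_apply]
    _ = ∫ x, 𝓕 (G : V → ℂ) x * f x := by
        refine integral_congr_ae ?_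
        filter_upwards [h2.coeFn_toLp] with x hx
        rw [hx, SchwartzMap.fourier_coe, smul_eq_mul]
    _ = ∫ x, G x * 𝓕 f x := integral_fourier_mul_eq G.integrable hf
    _ = ∫ x, g x • 𝓕 f x := by simp [hGg]

theorem eLpNorm_fourier {f : V → ℂ} (h1 : MemLp f 1) (h2 : MemLp f 2) :
    eLpNorm (𝓕 f) 2 volume = eLpNorm f 2 volume := by
  rw [← eLpNorm_congr_ae (coeFn_fourier_toLp h1 h2), ← eLpNorm_congr_ae h2.coeFn_toLp,
    ← Lp.enorm_def, ← Lp.enorm_def, ← ofReal_norm, ← ofReal_norm, Lp.norm_fourier_eq]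

theorem memLp_fourier {f : V → ℂ} (h1 : MemLp f 1) (h2 : MemLp f 2) : MemLp (𝓕 f) 2 :=
  (Lp.memLp _).ae_eq (coeFn_fourier_toLp h1 h2)

theorem fourier_conj_comp_sub (ψ : V → ℂ) (x ξ : V) :
    (starRingEnd ℂ) (𝓕 (fun t => (starRingEnd ℂ) (ψ (x - t))) ξ) =
      ((Real.fourierChar (inner ℝ x ξ) : Circle) : ℂ) * 𝓕 ψ ξ := by
  rw [Real.fourier_eq, Real.fourier_eq, ← integral_conj, ← integral_const_mul,
    ← integral_sub_left_eq_self _ volume x]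
  congr 1
  ext t
  simp only [Circle.smul_def, smul_eq_mul, map_mul, RingHomCompTriple.comp_apply, RingHom.id_apply,
    sub_sub_cancel]
  rw [← mul_assoc, ← Circle.coe_inv_eq_conj, ← AddChar.map_neg_eq_inv, neg_neg, inner_sub_left,
    sub_eq_add_neg, AddChar.map_add_eq_mul, Circle.coe_mul]

/-- The product of the `L²` Fourier transform of `f` and of `𝓕 ψ`. -/
noncomputable def fourierProd {f : V → ℂ} (hf : MemLp f 2) (ψ : V → ℂ) (ξ : V) : ℂ :=
  𝓕 ψ ξ * (𝓕 (hf.toLp f) : Lp ℂ 2 (volume : Measure V)) ξ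

theorem memLp_one_fourierProd {f ψ : V → ℂ} (hf : MemLp f 2) (h1 : MemLp ψ 1) (h2 : MemLp ψ 2) :
    MemLp (fourierProd hf ψ) 1 :=
  (Lp.memLp _).mul (memLp_fourier h1 h2)

theorem memLp_two_fourierProd {f ψ : V → ℂ} (hf : MemLp f 2) (h1 : MemLp ψ 1) :
    MemLp (fourierProd hf ψ) 2 := by
  have hψ : MemLp (𝓕 ψ) ⊤ := memLp_top_of_bound
    (continuous_fourier_of_integrable (memLp_one_iff_integrable.1 h1)).aestronglyMeasurable _
    (ae_of_all _ (norm_fourier_le ψ))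
  exact (Lp.memLp _).mul hψ

/-- The convolution at `x` is the `L²` pairing of `f` with `t ↦ conj (ψ (x - t))`; Plancherel turns
it into an inverse Fourier integral of the product of transforms. This holds at every `x`, without
inverting an `L²` transform pointwise. -/
theorem convolution_eq_fourier {f ψ : V → ℂ} (hf : MemLp f 2) (h1 : MemLp ψ 1) (h2 : MemLp ψ 2)
    (x : V) :
    convolution f ψ (ContinuousLinearMap.mul ℂ ℂ) volume x = 𝓕 (fourierProd hf ψ) (-x) := by
  set k : V → ℂ := fun t => (starRingEnd ℂ) (ψ (x - t)) with hk
  have mp : MeasurePreserving (fun t : V => x - t) volume volume :=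
    Measure.measurePreserving_sub_left volume x
  have k1 : MemLp k 1 := (h1.comp_measurePreserving mp).star
  have k2 : MemLp k 2 := (h2.comp_measurePreserving mp).star
  calc convolution f ψ (ContinuousLinearMap.mul ℂ ℂ) volume x
      = ∫ t, inner ℂ (k2.toLp k t) (hf.toLp f t) := by
        rw [convolution_def]
        refine integral_congr_ae ?_
        filter_upwards [k2.coeFn_toLp, hf.coeFn_toLp] with t h h'
        rw [h, h', RCLike.inner_apply]
        simp [hk]
    _ = inner ℂ (𝓕 (k2.toLp k)) (𝓕 (hf.toLp f) : Lp ℂ 2 (volume : Measure V)) := by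
        rw [Lp.inner_fourier_eq, L2.inner_def]
    _ = ∫ ξ, ((Real.fourierChar (inner ℝ x ξ) : Circle) : ℂ) * fourierProd hf ψ ξ := by
        rw [L2.inner_def]
        refine integral_congr_ae ?_
        filter_upwards [coeFn_fourier_toLp k1 k2] with ξ h
        rw [h, RCLike.inner_apply, fourier_conj_comp_sub, fourierProd]
        ring
    _ = 𝓕 (fourierProd hf ψ) (-x) := by
        rw [Real.fourier_eq]
        congr 1
        ext ξ
        rw [Circle.smul_def, smul_eq_mul, inner_neg_right, neg_neg, real_inner_comm]

theorem memLp_convolution {f ψ : V → ℂ} (hf : MemLp f 2) (h1 : MemLp ψ 1) (h2 : MemLp ψ 2) :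
    MemLp (convolution f ψ (ContinuousLinearMap.mul ℂ ℂ) volume) 2 := by
  rw [funext (convolution_eq_fourier hf h1 h2)]
  exact (memLp_fourier (memLp_one_fourierProd hf h1 h2)
    (memLp_two_fourierProd hf h1)).comp_measurePreserving (Measure.measurePreserving_neg volume)

theorem eLpNorm_two_sq {f : V → ℂ} : eLpNorm f 2 volume ^ 2 = ∫⁻ x, ‖f x‖ₑ ^ 2 := by
  rw [eLpNorm_eq_lintegral_rpow_enorm_toReal two_ne_zero ENNReal.ofNat_ne_top,
    ← ENNReal.rpow_natCast, ← ENNReal.rpow_mul]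
  simp

theorem eLpNorm_convolution_sq {f ψ : V → ℂ} (hf : MemLp f 2) (h1 : MemLp ψ 1)
    (h2 : MemLp ψ 2) :
    eLpNorm (convolution f ψ (ContinuousLinearMap.mul ℂ ℂ) volume) 2 volume ^ 2 =
      ∫⁻ ξ, ‖𝓕 ψ ξ‖ₑ ^ 2 * ‖(𝓕 (hf.toLp f) : Lp ℂ 2 (volume : Measure V)) ξ‖ₑ ^ 2 := by
  have g1 := memLp_one_fourierProd hf h1 h2
  have g2 := memLp_two_fourierProd hf h1
  rw [funext (convolution_eq_fourier hf h1 h2)]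
  have := eLpNorm_comp_measurePreserving (p := 2)
    (memLp_fourier g1 g2).aestronglyMeasurable (Measure.measurePreserving_neg (volume : Measure V))
  simp only [Function.comp_def] at this
  rw [this, eLpNorm_fourier g1 g2, eLpNorm_two_sq]
  simp [fourierProd, enorm_mul, mul_pow]

theorem lintegral_enorm_sq_fourier {f : V → ℂ} (hf : MemLp f 2) :
    ∫⁻ ξ, ‖(𝓕 (hf.toLp f) : Lp ℂ 2 (volume : Measure V)) ξ‖ₑ ^ 2 = eLpNorm f 2 volume ^ 2 := by
  rw [← eLpNorm_two_sq, ← eLpNorm_congr_ae hf.coeFn_toLp, ← Lp.enorm_def, ← Lp.enorm_def,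
    ← ofReal_norm, ← ofReal_norm, Lp.norm_fourier_eq]

theorem convolution_mul_sub_left {f g ψ : V → ℂ} (hf : MemLp f 2) (hg : MemLp g 2)
    (h2 : MemLp ψ 2) (x : V) :
    convolution (f - g) ψ (ContinuousLinearMap.mul ℂ ℂ) volume x =
      convolution f ψ (ContinuousLinearMap.mul ℂ ℂ) volume x -
      convolution g ψ (ContinuousLinearMap.mul ℂ ℂ) volume x := by
  have hk : MemLp (fun t => ψ (x - t)) 2 :=
    h2.comp_measurePreserving (Measure.measurePreserving_sub_left volume x)
  simp only [convolution_def, ContinuousLinearMap.mul_apply', Pi.sub_apply, sub_mul]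
  exact integral_sub (hf.integrable_mul hk) (hg.integrable_mul hk)

end Fourier

/-! ### Energy balance and stability of scattering layers for Bessel families -/

section Energy

variable {d : ℕ} {ι : Type*}

/-- A countable family of filters in `L¹ ∩ L²` satisfying a Bessel inequality with bound `1`. -/
structure IsBessel (Ψ : ι → EuclideanSpace ℝ (Fin d) → ℂ) : Prop where
  countable : Countable ι
  memLp_one : ∀ i, MemLp (Ψ i) 1 volume
  memLp_two : ∀ i, MemLp (Ψ i) 2 volume
  tsum_le : ∀ᵐ ξ, ∑' i, ‖𝓕 (Ψ i) ξ‖ₑ ^ 2 ≤ 1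

variable {Ψ : ι → EuclideanSpace ℝ (Fin d) → ℂ} {f g : EuclideanSpace ℝ (Fin d) → ℂ}

theorem memLp_step {ψ : EuclideanSpace ℝ (Fin d) → ℂ} (hf : MemLp f 2) (h1 : MemLp ψ 1)
    (h2 : MemLp ψ 2) : MemLp (step f ψ) 2 :=
  (memLp_convolution hf h1 h2).norm.ofReal

theorem eLpNorm_step (f ψ : EuclideanSpace ℝ (Fin d) → ℂ) :
    eLpNorm (step f ψ) 2 volume =
      eLpNorm (convolution f ψ (ContinuousLinearMap.mul ℂ ℂ) volume) 2 volume :=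
  eLpNorm_congr_norm_ae (ae_of_all _ fun x => by simp [step])

theorem eLpNorm_step_sub_step_le {ψ : EuclideanSpace ℝ (Fin d) → ℂ} (hf : MemLp f 2)
    (hg : MemLp g 2) (h2 : MemLp ψ 2) :
    eLpNorm (step f ψ - step g ψ) 2 volume ≤ eLpNorm (step (f - g) ψ) 2 volume := by
  rw [eLpNorm_step]
  refine eLpNorm_mono fun x => ?_
  rw [convolution_mul_sub_left hf hg h2, Pi.sub_apply, step, step, ← Complex.ofReal_sub,
    Complex.norm_real, Real.norm_eq_abs]
  exact abs_norm_sub_norm_le _ _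

theorem step_congr_ae (ψ : EuclideanSpace ℝ (Fin d) → ℂ) (h : f =ᵐ[volume] g) :
    step f ψ = step g ψ := by
  ext x
  simp only [step, convolution_def]
  congr 2
  refine integral_congr_ae ?_
  filter_upwards [h] with t ht
  rw [ht]

theorem propagator_cons (ψ : EuclideanSpace ℝ (Fin d) → ℂ)
    (p : List (EuclideanSpace ℝ (Fin d) → ℂ)) (f : EuclideanSpace ℝ (Fin d) → ℂ) :
    propagator (ψ :: p) f = propagator p (step f ψ) := rfl

theorem propagator_ofFn_cons {N : ℕ} (Ψ : ι → EuclideanSpace ℝ (Fin d) → ℂ) (i : ι)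
    (p : Fin N → ι) (f : EuclideanSpace ℝ (Fin d) → ℂ) :
    propagator (List.ofFn fun n => Ψ ((Fin.cons i p : Fin (N + 1) → ι) n)) f =
      propagator (List.ofFn fun n => Ψ (p n)) (step f (Ψ i)) := by
  rw [List.ofFn_succ, propagator_cons]
  simp

theorem tsum_path_succ {N : ℕ} (F : (Fin (N + 1) → ι) → ℝ≥0∞) :
    ∑' p, F p = ∑' i, ∑' p : Fin N → ι, F (Fin.cons i p) := by
  rw [← (Fin.consEquiv fun _ : Fin (N + 1) => ι).tsum_eq]
  exact ENNReal.tsum_prod (f := fun (i : ι) (p : Fin N → ι) => F (Fin.cons i p))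

theorem energyRemainder_zero (Ψ : ι → EuclideanSpace ℝ (Fin d) → ℂ)
    (f : EuclideanSpace ℝ (Fin d) → ℂ) :
    energyRemainder Ψ 0 f = eLpNorm f 2 volume ^ 2 := by
  rw [energyRemainder, tsum_eq_single (fun n => n.elim0) fun p hp => (hp (Subsingleton.elim _ _)).elim]
  simp [propagator]

theorem energyRemainder_succ (Ψ : ι → EuclideanSpace ℝ (Fin d) → ℂ) (N : ℕ)
    (f : EuclideanSpace ℝ (Fin d) → ℂ) :
    energyRemainder Ψ (N + 1) f = ∑' i, energyRemainder Ψ N (step f (Ψ i)) := by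
  simp only [energyRemainder]
  rw [tsum_path_succ]
  simp only [propagator_ofFn_cons]

/-- One convolution already erases the choice of representative, so the remainder is well defined on
`L²` classes. -/
theorem energyRemainder_congr_ae (Ψ : ι → EuclideanSpace ℝ (Fin d) → ℂ) (N : ℕ)
    (h : f =ᵐ[volume] g) : energyRemainder Ψ N f = energyRemainder Ψ N g := by
  cases N with
  | zero => rw [energyRemainder_zero, energyRemainder_zero, eLpNorm_congr_ae h]
  | succ N => simp only [energyRemainder_succ, step_congr_ae _ h]

/-- The squared distance between the layer-`N` outputs of `f` and `g`. -/
noncomputable def layerDist (Ψ : ι → EuclideanSpace ℝ (Fin d) → ℂ) (N : ℕ)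
    (f g : EuclideanSpace ℝ (Fin d) → ℂ) : ℝ≥0∞ :=
  ∑' p : Fin N → ι, eLpNorm (propagator (List.ofFn fun n => Ψ (p n)) f -
    propagator (List.ofFn fun n => Ψ (p n)) g) 2 volume ^ 2

theorem layerDist_zero (Ψ : ι → EuclideanSpace ℝ (Fin d) → ℂ)
    (f g : EuclideanSpace ℝ (Fin d) → ℂ) :
    layerDist Ψ 0 f g = eLpNorm (f - g) 2 volume ^ 2 := by
  rw [layerDist, tsum_eq_single (fun n => n.elim0) fun p hp => (hp (Subsingleton.elim _ _)).elim]
  simp [propagator]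

theorem layerDist_succ (Ψ : ι → EuclideanSpace ℝ (Fin d) → ℂ) (N : ℕ)
    (f g : EuclideanSpace ℝ (Fin d) → ℂ) :
    layerDist Ψ (N + 1) f g = ∑' i, layerDist Ψ N (step f (Ψ i)) (step g (Ψ i)) := by
  simp only [layerDist]
  rw [tsum_path_succ]
  simp only [propagator_ofFn_cons]

theorem tsum_eLpNorm_step_sq [Countable ι] (h1 : ∀ i, MemLp (Ψ i) 1 volume)
    (h2 : ∀ i, MemLp (Ψ i) 2 volume) (hf : MemLp f 2) :
    ∑' i, eLpNorm (step f (Ψ i)) 2 volume ^ 2 =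
      ∫⁻ ξ, (∑' i, ‖𝓕 (Ψ i) ξ‖ₑ ^ 2) *
        ‖(𝓕 (hf.toLp f) : Lp ℂ 2 (volume : Measure (EuclideanSpace ℝ (Fin d)))) ξ‖ₑ ^ 2 := by
  simp only [← ENNReal.tsum_mul_right]
  rw [lintegral_tsum]
  · exact tsum_congr fun i => by rw [eLpNorm_step, eLpNorm_convolution_sq hf (h1 i) (h2 i)]
  · intro i
    exact (((memLp_fourier (h1 i) (h2 i)).aestronglyMeasurable.enorm).pow_const _).mul
      ((Lp.aestronglyMeasurable _).enorm.pow_const _)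

theorem IsBessel.tsum_step_le (h : IsBessel Ψ) (hf : MemLp f 2) :
    ∑' i, eLpNorm (step f (Ψ i)) 2 volume ^ 2 ≤ eLpNorm f 2 volume ^ 2 := by
  have := h.countable
  rw [tsum_eLpNorm_step_sq h.memLp_one h.memLp_two hf, ← lintegral_enorm_sq_fourier hf]
  refine lintegral_mono_ae ?_
  filter_upwards [h.tsum_le] with ξ hξ
  exact mul_le_of_le_one_left' hξ

theorem IsBessel.memLp_step (h : IsBessel Ψ) (hf : MemLp f 2) (i : ι) :
    MemLp (step f (Ψ i)) 2 :=
  Scattering.memLp_step hf (h.memLp_one i) (h.memLp_two i)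

theorem IsBessel.energyRemainder_succ_le (h : IsBessel Ψ) (N : ℕ) (hf : MemLp f 2) :
    energyRemainder Ψ (N + 1) f ≤ energyRemainder Ψ N f := by
  induction N generalizing f with
  | zero =>
    simp only [energyRemainder_succ, energyRemainder_zero]
    exact h.tsum_step_le hf
  | succ N ih =>
    rw [energyRemainder_succ, energyRemainder_succ Ψ N]
    exact ENNReal.tsum_le_tsum fun i => ih (h.memLp_step hf i)

theorem IsBessel.antitone_energyRemainder (h : IsBessel Ψ) (hf : MemLp f 2) :
    Antitone fun N => energyRemainder Ψ N f :=
  antitone_nat_of_succ_le fun N => h.energyRemainder_succ_le N hf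

/-- For a tight family Plancherel gives equality in each step, and taking the modulus does not
change the norm, so no energy is lost. -/
theorem IsBessel.energyRemainder_eq (h : IsBessel Ψ)
    (htight : ∀ᵐ ξ, ∑' i, ‖𝓕 (Ψ i) ξ‖ₑ ^ 2 = 1) (N : ℕ) (hf : MemLp f 2) :
    energyRemainder Ψ N f = eLpNorm f 2 volume ^ 2 := by
  have := h.countable
  induction N generalizing f with
  | zero => exact energyRemainder_zero Ψ f
  | succ N ih =>
    rw [energyRemainder_succ, tsum_congr fun i => ih (h.memLp_step hf i),
      tsum_eLpNorm_step_sq h.memLp_one h.memLp_two hf, ← lintegral_enorm_sq_fourier hf]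
    refine lintegral_congr_ae ?_
    filter_upwards [htight] with ξ hξ
    rw [hξ, one_mul]

/-- The scattering layers are nonexpansive. -/
theorem IsBessel.layerDist_le (h : IsBessel Ψ) (N : ℕ) (hf : MemLp f 2) (hg : MemLp g 2) :
    layerDist Ψ N f g ≤ eLpNorm (f - g) 2 volume ^ 2 := by
  induction N generalizing f g with
  | zero => exact (layerDist_zero Ψ f g).le
  | succ N ih =>
    rw [layerDist_succ]
    refine le_trans (ENNReal.tsum_le_tsum fun i => ?_) (h.tsum_step_le (hf.sub hg))
    refine (ih (h.memLp_step hf i) (h.memLp_step hg i)).trans ?_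
    gcongr
    exact eLpNorm_step_sub_step_le hf hg (h.memLp_two i)

theorem IsBessel.memLp_propagator (h : IsBessel Ψ) {N : ℕ} (p : Fin N → ι) (hf : MemLp f 2) :
    MemLp (propagator (List.ofFn fun n => Ψ (p n)) f) 2 := by
  induction N generalizing f with
  | zero => simpa [propagator] using hf
  | succ N ih =>
    rw [List.ofFn_succ, propagator_cons]
    exact ih _ (h.memLp_step hf _)

theorem ennreal_sq_add_le (x y : ℝ≥0∞) : (x + y) ^ 2 ≤ 2 * x ^ 2 + 2 * y ^ 2 := by
  have := ENNReal.rpow_add_le_mul_rpow_add_rpow x y (p := 2) one_le_two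
  norm_num at this
  rwa [mul_add] at this

theorem eLpNorm_sq_le_add {u v : EuclideanSpace ℝ (Fin d) → ℂ} (hu : MemLp u 2)
    (hv : MemLp v 2) :
    eLpNorm u 2 volume ^ 2 ≤ 2 * eLpNorm v 2 volume ^ 2 + 2 * eLpNorm (v - u) 2 volume ^ 2 := by
  refine le_trans ?_ (ennreal_sq_add_le _ _)
  gcongr
  calc eLpNorm u 2 volume = eLpNorm (v - (v - u)) 2 volume := by rw [sub_sub_cancel]
    _ ≤ _ := eLpNorm_sub_le hv.aestronglyMeasurable (hv.sub hu).aestronglyMeasurable one_le_two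

/-- The error term does not depend on `N`, because the layers are nonexpansive. This is the only
form of continuity used in the gliding hump and Baire arguments. -/
theorem IsBessel.energyRemainder_le_add (h : IsBessel Ψ) (N : ℕ) (hf : MemLp f 2)
    (hg : MemLp g 2) :
    energyRemainder Ψ N f ≤
      2 * energyRemainder Ψ N g + 2 * eLpNorm (g - f) 2 volume ^ 2 := by
  calc energyRemainder Ψ N f
      ≤ 2 * energyRemainder Ψ N g + 2 * layerDist Ψ N g f := by
        rw [energyRemainder, energyRemainder, layerDist, ← ENNReal.tsum_mul_left,
          ← ENNReal.tsum_mul_left, ← ENNReal.tsum_add]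
        exact ENNReal.tsum_le_tsum fun p =>
          eLpNorm_sq_le_add (h.memLp_propagator p hf) (h.memLp_propagator p hg)
    _ ≤ _ := by gcongr; exact h.layerDist_le N hg hf

/-- A single scattering path is controlled by its first filter. -/
theorem IsBessel.eLpNorm_propagator_sub_le (h : IsBessel Ψ) {N : ℕ} (p : Fin (N + 1) → ι)
    (hf : MemLp f 2) (hg : MemLp g 2) :
    eLpNorm (propagator (List.ofFn fun n => Ψ (p n)) f -
      propagator (List.ofFn fun n => Ψ (p n)) g) 2 volume ^ 2 ≤
      eLpNorm (step (f - g) (Ψ (p 0))) 2 volume ^ 2 := by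
  rw [List.ofFn_succ, propagator_cons, propagator_cons]
  refine le_trans (ENNReal.le_tsum (f := fun q : Fin N → ι =>
    eLpNorm (propagator (List.ofFn fun n => Ψ (q n)) (step f (Ψ (p 0))) -
      propagator (List.ofFn fun n => Ψ (q n)) (step g (Ψ (p 0)))) 2 volume ^ 2)
    (fun n : Fin N => p n.succ)) ?_
  refine (h.layerDist_le N (h.memLp_step hf (p 0)) (h.memLp_step hg (p 0))).trans ?_
  gcongr
  exact eLpNorm_step_sub_step_le hf hg (h.memLp_two _)

theorem IsBessel.comp {κ : Type*} (h : IsBessel Ψ) {e : κ → ι} (he : Function.Injective e) :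
    IsBessel fun k => Ψ (e k) where
  countable := have := h.countable; he.countable
  memLp_one k := h.memLp_one _
  memLp_two k := h.memLp_two _
  tsum_le := by
    filter_upwards [h.tsum_le] with ξ hξ
    exact (ENNReal.tsum_comp_le_tsum_of_injective he fun i => ‖𝓕 (Ψ i) ξ‖ₑ ^ 2).trans hξ

end Energy

/-! ### Change of variables and dilation covariance -/

section Dilation

variable {d : ℕ} {A B : Matrix (Fin d) (Fin d) ℝ} {f g ψ : EuclideanSpace ℝ (Fin d) → ℂ}

theorem map_toEuclideanLin_volume (hA : A.det ≠ 0) :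
    Measure.map (Matrix.toEuclideanLin A) (volume : Measure (EuclideanSpace ℝ (Fin d))) =
      ENNReal.ofReal |A.det|⁻¹ • volume := by
  have hdet : LinearMap.det (Matrix.toEuclideanLin A) = A.det := LinearMap.det_toLpLin 2 A
  rw [Measure.map_linearMap_addHaar_eq_smul_addHaar _ (by rwa [hdet]), hdet, abs_inv]

theorem toEuclideanLin_mul_apply (A B : Matrix (Fin d) (Fin d) ℝ)
    (x : EuclideanSpace ℝ (Fin d)) :
    Matrix.toEuclideanLin (A * B) x = Matrix.toEuclideanLin A (Matrix.toEuclideanLin B x) := by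
  rw [Matrix.toLpLin_mul_same]; rfl

theorem toEuclideanLin_one_apply (x : EuclideanSpace ℝ (Fin d)) :
    Matrix.toEuclideanLin (1 : Matrix (Fin d) (Fin d) ℝ) x = x := by
  rw [Matrix.toLpLin_one]; rfl

theorem measurableEmbedding_toEuclideanLin (hA : A.det ≠ 0) :
    MeasurableEmbedding (Matrix.toEuclideanLin A : EuclideanSpace ℝ (Fin d) → _) := by
  refine (LinearMap.continuous_of_finiteDimensional _).measurableEmbedding ?_
  have h : A⁻¹ * A = 1 := Matrix.nonsing_inv_mul _ hA.isUnit
  refine Function.LeftInverse.injective (g := Matrix.toEuclideanLin A⁻¹) fun x => ?_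
  rw [← toEuclideanLin_mul_apply, h, toEuclideanLin_one_apply]

theorem quasiMeasurePreserving_toEuclideanLin (hA : A.det ≠ 0) :
    Measure.QuasiMeasurePreserving
      (Matrix.toEuclideanLin A : EuclideanSpace ℝ (Fin d) → _) volume volume :=
  ⟨(measurableEmbedding_toEuclideanLin hA).measurable, by
    rw [map_toEuclideanLin_volume hA]; exact Measure.smul_absolutelyContinuous⟩

theorem integral_comp_toEuclideanLin (hA : A.det ≠ 0) (g : EuclideanSpace ℝ (Fin d) → ℂ) :
    ∫ x, ((|A.det| : ℝ) : ℂ) * g (Matrix.toEuclideanLin A x) = ∫ x, g x := by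
  rw [integral_const_mul, ← (measurableEmbedding_toEuclideanLin hA).integral_map,
    map_toEuclideanLin_volume hA, integral_smul_measure,
    ENNReal.toReal_ofReal (inv_nonneg.2 (abs_nonneg _)), Complex.real_smul, ← mul_assoc,
    ← Complex.ofReal_mul, mul_inv_cancel₀ (abs_ne_zero.2 hA), Complex.ofReal_one, one_mul]

theorem lintegral_comp_toEuclideanLin (hA : A.det ≠ 0)
    (g : EuclideanSpace ℝ (Fin d) → ℝ≥0∞) :
    ∫⁻ x, g (Matrix.toEuclideanLin A x) = ENNReal.ofReal |A.det|⁻¹ * ∫⁻ x, g x := by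
  rw [← (measurableEmbedding_toEuclideanLin hA).lintegral_map, map_toEuclideanLin_volume hA,
    lintegral_smul_measure, smul_eq_mul]

theorem memLp_comp_toEuclideanLin {p : ℝ≥0∞} (hA : A.det ≠ 0) (hf : MemLp f p) :
    MemLp (fun x => f (Matrix.toEuclideanLin A x)) p := by
  have := hf.smul_measure (c := ENNReal.ofReal |A.det|⁻¹) ENNReal.ofReal_ne_top
  rw [← map_toEuclideanLin_volume hA,
    (measurableEmbedding_toEuclideanLin hA).memLp_map_measure_iff] at this
  exact this

theorem memLp_dilation {p : ℝ≥0∞} (hA : A.det ≠ 0) (hf : MemLp f p) :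
    MemLp (dilation A f) p :=
  (memLp_comp_toEuclideanLin hA hf).const_mul _

theorem inner_toEuclideanLin (A : Matrix (Fin d) (Fin d) ℝ) (x y : EuclideanSpace ℝ (Fin d)) :
    inner ℝ (Matrix.toEuclideanLin A x) y = inner ℝ x (Matrix.toEuclideanLin A.transpose y) := by
  rw [← Matrix.conjTranspose_eq_transpose_of_trivial,
    Matrix.toEuclideanLin_conjTranspose_eq_adjoint, LinearMap.adjoint_inner_right]

theorem fourier_dilation (hAB : A.transpose * B = 1) (ψ : EuclideanSpace ℝ (Fin d) → ℂ)
    (ξ : EuclideanSpace ℝ (Fin d)) :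
    𝓕 (dilation A ψ) ξ = 𝓕 ψ (Matrix.toEuclideanLin B ξ) := by
  have hA : A.det ≠ 0 := by
    intro h
    have := congrArg Matrix.det hAB
    simp [h] at this
  rw [Real.fourier_eq, Real.fourier_eq, ← integral_comp_toEuclideanLin hA
    fun x => Real.fourierChar (-inner ℝ x (Matrix.toEuclideanLin B ξ)) • ψ x]
  congr 1
  ext x
  rw [inner_toEuclideanLin, ← toEuclideanLin_mul_apply, hAB, toEuclideanLin_one_apply, dilation,
    Circle.smul_def, Circle.smul_def, smul_eq_mul, smul_eq_mul, mul_left_comm]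

theorem dilation_dilation (A B : Matrix (Fin d) (Fin d) ℝ) (ψ : EuclideanSpace ℝ (Fin d) → ℂ) :
    dilation A (dilation B ψ) = dilation (B * A) ψ := by
  ext x
  simp only [dilation, toEuclideanLin_mul_apply, Matrix.det_mul, abs_mul, Complex.ofReal_mul]
  ring

/-- The `L²`-normalized dilation. -/
noncomputable def rescale (A : Matrix (Fin d) (Fin d) ℝ) (f : EuclideanSpace ℝ (Fin d) → ℂ) :
    EuclideanSpace ℝ (Fin d) → ℂ :=
  fun x => ((√|A.det| : ℝ) : ℂ) * f (Matrix.toEuclideanLin A x)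

theorem memLp_rescale {p : ℝ≥0∞} (hA : A.det ≠ 0) (hf : MemLp f p) : MemLp (rescale A f) p :=
  (memLp_comp_toEuclideanLin hA hf).const_mul _

theorem eLpNorm_rescale_sq (hA : A.det ≠ 0) (f : EuclideanSpace ℝ (Fin d) → ℂ) :
    eLpNorm (rescale A f) 2 volume ^ 2 = eLpNorm f 2 volume ^ 2 := by
  have h0 : 0 < |A.det| := abs_pos.2 hA
  rw [eLpNorm_two_sq, eLpNorm_two_sq]
  simp only [rescale, enorm_mul, mul_pow]
  rw [lintegral_const_mul' _ _ (by finiteness),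
    lintegral_comp_toEuclideanLin hA (fun x => ‖f x‖ₑ ^ 2), ← mul_assoc]
  have : ‖((√|A.det| : ℝ) : ℂ)‖ₑ ^ 2 = ENNReal.ofReal |A.det| := by
    rw [← ofReal_norm, Complex.norm_real, Real.norm_of_nonneg (Real.sqrt_nonneg _),
      ← ENNReal.ofReal_pow (Real.sqrt_nonneg _), Real.sq_sqrt h0.le]
  rw [this, ← ENNReal.ofReal_mul h0.le, mul_inv_cancel₀ h0.ne', ENNReal.ofReal_one, one_mul]

theorem step_rescale (hA : A.det ≠ 0) (f ψ : EuclideanSpace ℝ (Fin d) → ℂ) :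
    step (rescale A f) (dilation A ψ) = rescale A (step f ψ) := by
  ext x
  simp only [step, rescale, convolution_def, ContinuousLinearMap.mul_apply']
  rw [← integral_comp_toEuclideanLin hA
    (fun t => f t * ψ (Matrix.toEuclideanLin A x - t)), ← Complex.ofReal_mul]
  congr 1
  rw [← Real.norm_of_nonneg (Real.sqrt_nonneg |A.det|), ← Complex.norm_real, ← norm_mul,
    ← integral_const_mul]
  congr 2
  ext t
  simp only [dilation, map_sub, Complex.norm_real, Real.norm_of_nonneg (Real.sqrt_nonneg |A.det|)]
  ring

/-- With `L²` normalization on signals and `L¹` normalization on filters the Jacobians cancel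
exactly, so covariance passes through every layer. -/
theorem propagator_rescale (hA : A.det ≠ 0) (p : List (EuclideanSpace ℝ (Fin d) → ℂ))
    (f : EuclideanSpace ℝ (Fin d) → ℂ) :
    propagator (p.map (dilation A)) (rescale A f) = rescale A (propagator p f) := by
  induction p generalizing f with
  | nil => rfl
  | cons ψ p ih => rw [List.map_cons, propagator_cons, propagator_cons, step_rescale hA, ih]

end Dilation

/-! ### Tightness over all scales, and bumps visible at a given depth -/

section Wavelet

variable {d : ℕ} {a : ℝ} {G : Subgroup (Matrix.orthogonalGroup (Fin d) ℝ)}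
  {ψ φ : EuclideanSpace ℝ (Fin d) → ℂ}

/-- The wavelet-generated filters at all scales. -/
noncomputable def fullWav (ψ : EuclideanSpace ℝ (Fin d) → ℂ) (a : ℝ)
    (G : Subgroup (Matrix.orthogonalGroup (Fin d) ℝ)) :
    ℤ × G → EuclideanSpace ℝ (Fin d) → ℂ :=
  fun i => dilation (a ^ i.1 • i.2.1.1).transpose ψ

theorem zpow_smul_mul_inv (ha : 0 < a) (j : ℤ) (M : Matrix.orthogonalGroup (Fin d) ℝ) :
    (a ^ j • M.1) * ((a ^ j)⁻¹ • (M⁻¹).1) = 1 := by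
  have h : M.1 * (M⁻¹).1 = 1 := congrArg Subtype.val (mul_inv_cancel M)
  rw [smul_mul_smul_comm, h, mul_inv_cancel₀ (zpow_pos ha j).ne', one_smul]

theorem det_zpow_smul_ne_zero (ha : 0 < a) (j : ℤ) (M : Matrix.orthogonalGroup (Fin d) ℝ) :
    (a ^ j • M.1).transpose.det ≠ 0 := by
  intro h
  have := congrArg Matrix.det (zpow_smul_mul_inv ha j M)
  rw [Matrix.det_transpose] at h
  simp only [Matrix.det_mul, h, zero_mul, Matrix.det_one] at this
  exact zero_ne_one this

theorem fourier_fullWav (ha : 0 < a) (i : ℤ × G) (ξ : EuclideanSpace ℝ (Fin d)) :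
    𝓕 (fullWav ψ a G i) ξ =
      𝓕 ψ ((a ^ i.1)⁻¹ • Matrix.toEuclideanLin (i.2.1⁻¹).1 ξ) := by
  rw [fullWav, fourier_dilation (B := (a ^ i.1)⁻¹ • (i.2.1⁻¹).1)]
  · rw [map_smul, LinearMap.smul_apply]
  · rw [Matrix.transpose_transpose, zpow_smul_mul_inv ha]

theorem ae_smul {P : EuclideanSpace ℝ (Fin d) → Prop} (h : ∀ᵐ ξ, P ξ) {c : ℝ} (hc : c ≠ 0) :
    ∀ᵐ ξ, P (c • ξ) := by
  have hdet : (c • (1 : Matrix (Fin d) (Fin d) ℝ)).det ≠ 0 := by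
    rw [Matrix.det_smul]; simp [hc]
  filter_upwards [(quasiMeasurePreserving_toEuclideanLin hdet).ae h] with ξ hξ
  rwa [map_smul, LinearMap.smul_apply, toEuclideanLin_one_apply] at hξ

theorem tendsto_fourier_pow_smul (φ : EuclideanSpace ℝ (Fin d) → ℂ) (ha : 1 < a)
    {ξ : EuclideanSpace ℝ (Fin d)} (hξ : ξ ≠ 0) :
    Tendsto (fun n : ℕ => ‖𝓕 φ (a ^ n • ξ)‖ₑ ^ 2) atTop (𝓝 0) := by
  have h : Tendsto (fun n : ℕ => a ^ n • ξ) atTop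
      (cocompact (EuclideanSpace ℝ (Fin d))) := by
    rw [← Metric.cobounded_eq_cocompact, ← tendsto_norm_atTop_iff_cobounded]
    simp only [norm_smul, norm_pow, Real.norm_of_nonneg (zero_lt_one.trans ha).le]
    exact (tendsto_pow_atTop_atTop_of_one_lt ha).atTop_mul_const (norm_pos_iff.2 hξ)
  have := ((tendsto_integral_exp_inner_smul_cocompact φ).comp h).enorm
  rw [enorm_zero] at this
  have h2 := ENNReal.Tendsto.pow (n := 2) this
  rw [zero_pow two_ne_zero] at h2
  exact h2

/-- The wavelets at all scales form a tight family. -/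
theorem Admissible.tsum_fullWav (h : Admissible a G ψ φ) (hd : 1 ≤ d) (ha : 1 < a) :
    ∀ᵐ ξ, ∑' i, ‖𝓕 (fullWav ψ a G i) ξ‖ₑ ^ 2 = 1 := by
  have ha0 : 0 < a := zero_lt_one.trans ha
  have : Nonempty (Fin d) := ⟨⟨0, hd⟩⟩
  have hne : ∀ᵐ ξ : EuclideanSpace ℝ (Fin d), ξ ≠ 0 := Measure.ae_ne volume 0
  have hall : ∀ᵐ ξ : EuclideanSpace ℝ (Fin d), ∀ n : ℕ, _ :=
    ae_all_iff.2 fun n : ℕ => ae_smul h.littlewoodPaley (pow_pos ha0 n).ne'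
  filter_upwards [hne, hall] with ξ hξ hLP
  set F : ℤ → ℝ≥0∞ := fun j => ∑' M : G, ‖𝓕 (fullWav ψ a G (j, M)) ξ‖ₑ ^ 2 with hF
  have hsum : ∑' i, ‖𝓕 (fullWav ψ a G i) ξ‖ₑ ^ 2 = ∑' j, F j :=
    ENNReal.tsum_prod (f := fun j M => ‖𝓕 (fullWav ψ a G (j, M)) ξ‖ₑ ^ 2)
  -- At `a ^ n • ξ` the identity covers exactly the scales above `-n`. Discarding the low-pass term
  -- bounds finite sums by `1`; its vanishing as `n → ∞` gives the reverse bound.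
  have hLP' : ∀ n : ℕ, ‖𝓕 φ (a ^ n • ξ)‖ₑ ^ 2 + ∑' j : ℕ, F ((j : ℤ) + 1 - n) = 1 := by
    intro n
    rw [← hLP n]
    congr 1
    refine tsum_congr fun j => tsum_congr fun M => ?_
    rw [fourier_fullWav ha0, map_smul, smul_smul]
    congr 4
    rw [zpow_sub₀ ha0.ne', inv_div, div_eq_inv_mul]
    norm_cast
  rw [hsum]
  refine le_antisymm ?_ ?_
  · rw [ENNReal.tsum_eq_iSup_sum]
    refine iSup_le fun s => ?_
    obtain ⟨n, hn⟩ : ∃ n : ℕ, ∀ j ∈ s, 1 - j ≤ n := by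
      refine ⟨∑ j ∈ s, (1 - j).toNat, fun j hj => ?_⟩
      have := Finset.single_le_sum (f := fun j : ℤ => (1 - j).toNat) (fun _ _ => Nat.zero_le _) hj
      have h2 := Int.self_le_toNat (1 - j)
      omega
    rw [← hLP' n]
    refine le_trans ?_ le_add_self
    have hs : ∑ j ∈ s, F j = ∑ m ∈ s.image (fun j : ℤ => (j - 1 + (n : ℤ)).toNat), F ((m : ℤ) + 1 - n) := by
      rw [Finset.sum_image]
      · refine Finset.sum_congr rfl fun j hj => ?_
        have := hn j hj
        congr 1
        omega
      · intro j hj k hk hjk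
        have h1 := hn j hj
        have h2 := hn k hk
        simp only at hjk
        omega
    rw [hs]
    exact ENNReal.sum_le_tsum _
  · have hlim := (tendsto_fourier_pow_smul φ ha hξ).add_const (∑' j, F j)
    rw [zero_add] at hlim
    refine ge_of_tendsto' hlim fun n => ?_
    rw [← hLP' n]
    gcongr
    exact ENNReal.tsum_comp_le_tsum_of_injective
      (f := fun j : ℕ => (j : ℤ) + 1 - n) (fun j k hjk => by simp only at hjk; omega) F

theorem Admissible.isBessel_fullWav (h : Admissible a G ψ φ) (hd : 1 ≤ d) (ha : 1 < a)
    (hG : Finite G) : IsBessel (fullWav ψ a G) where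
  countable := inferInstance
  memLp_one _ := memLp_dilation (det_zpow_smul_ne_zero (zero_lt_one.trans ha) _ _) h.memLp_one_psi
  memLp_two _ := memLp_dilation (det_zpow_smul_ne_zero (zero_lt_one.trans ha) _ _) h.memLp_two_psi
  tsum_le := (h.tsum_fullWav hd ha).mono fun _ hξ => hξ.le

/-- Scaling by `aᵏ`. -/
noncomputable def scaleMatrix (d : ℕ) (a : ℝ) (k : ℕ) : Matrix (Fin d) (Fin d) ℝ :=
  a ^ k • 1

theorem det_scaleMatrix_ne_zero (ha : 0 < a) (k : ℕ) : (scaleMatrix d a k).det ≠ 0 := by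
  rw [scaleMatrix, Matrix.det_smul]; simp [ha.ne']

theorem dilation_fullWav (ha : 0 < a) (k : ℕ) (i : ℤ × G) :
    dilation (scaleMatrix d a k) (fullWav ψ a G i) = fullWav ψ a G (i.1 + k, i.2) := by
  rw [fullWav, dilation_dilation, fullWav, scaleMatrix, Matrix.mul_smul, mul_one,
    Matrix.transpose_smul, Matrix.transpose_smul, smul_smul, zpow_add₀ ha.ne', zpow_natCast,
    mul_comm]

theorem eLpNorm_propagator_rescale_sq (ha : 0 < a) {N : ℕ} (k : ℕ) (p : Fin N → ℤ × G)
    (f : EuclideanSpace ℝ (Fin d) → ℂ) :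
    eLpNorm (propagator (List.ofFn fun n => fullWav ψ a G ((p n).1 + k, (p n).2))
      (rescale (scaleMatrix d a k) f)) 2 volume ^ 2 =
    eLpNorm (propagator (List.ofFn fun n => fullWav ψ a G (p n)) f) 2 volume ^ 2 := by
  simp only [← dilation_fullWav ha]
  rw [← Function.comp_def (dilation (scaleMatrix d a k)), ← List.map_ofFn,
    propagator_rescale (det_scaleMatrix_ne_zero ha k),
    eLpNorm_rescale_sq (det_scaleMatrix_ne_zero ha k)]

/-- The family `Wav` is a subfamily of `fullWav` which contains all scales above `-J`. -/
theorem exists_wav_eq_fullWav (hd : 1 ≤ d) (ha : 1 < a) (J : ℤ)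
    (ψ : EuclideanSpace ℝ (Fin d) → ℂ) :
    ∃ s : Lam a G J → ℤ × G, Function.Injective s ∧
      (∀ l, Wav ψ a G J l = fullWav ψ a G (s l)) ∧ ∀ i : ℤ × G, -J < i.1 → ∃ l, s l = i := by
  have ha0 : 0 < a := zero_lt_one.trans ha
  have hex : ∀ l : Lam a G J, ∃ i : ℤ × G, l.1 = a ^ i.1 • i.2.1.1 := by
    rintro ⟨A, j, -, M, hM, hA⟩
    exact ⟨(j, ⟨M, hM⟩), hA⟩
  choose s hs using hex
  refine ⟨s, fun l l' h => Subtype.ext (by rw [hs, hs, h]), fun l => by rw [Wav, fullWav, hs],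
    fun i hi => ⟨⟨a ^ i.1 • i.2.1.1, i.1, hi, i.2.1, i.2.2, rfl⟩, ?_⟩⟩
  set l : Lam a G J := ⟨a ^ i.1 • i.2.1.1, i.1, hi, i.2.1, i.2.2, rfl⟩
  have h : a ^ i.1 • i.2.1.1 = a ^ (s l).1 • (s l).2.1.1 := hs l
  -- A diagonal entry of `A * Aᵀ` recovers the scale from the matrix, so the pair `(j, M)` is
  -- determined by `a ^ j • M`; a diagonal entry exists because `1 ≤ d`.
  have key : ∀ (c : ℝ) (M : Matrix.orthogonalGroup (Fin d) ℝ),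
      ((c • M.1) * (c • M.1).transpose) ⟨0, hd⟩ ⟨0, hd⟩ = c ^ 2 := by
    intro c M
    have hM : M.1 * M.1.transpose = 1 := (Matrix.mem_orthogonalGroup_iff _ _).1 M.2
    rw [Matrix.transpose_smul, smul_mul_smul_comm, hM]
    simp [sq]
  have h1 : (a ^ i.1) = (a ^ (s l).1) := by
    have := key (a ^ i.1) i.2.1
    rw [h, key] at this
    exact ((sq_eq_sq₀ (zpow_pos ha0 _).le (zpow_pos ha0 _).le).1 this).symm
  rw [← h1] at h
  refine Prod.ext (zpow_right_injective₀ ha0 ha.ne' h1).symm (Subtype.ext (Subtype.ext ?_))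
  exact (smul_right_injective _ (zpow_pos ha0 i.1).ne' h).symm

theorem Admissible.isBessel_wav (h : Admissible a G ψ φ) (hd : 1 ≤ d) (ha : 1 < a)
    (hG : Finite G) (J : ℤ) : IsBessel (Wav ψ a G J) := by
  obtain ⟨s, hs, hw, -⟩ := exists_wav_eq_fullWav (G := G) hd ha J ψ
  rw [funext hw]
  exact (h.isBessel_fullWav hd ha hG).comp hs

/-- Adding a sufficiently dilated copy of `u` to `h` produces an energy remainder comparable
with the energy of `u`. -/
theorem Admissible.exists_rescale (had : Admissible a G ψ φ) (hd : 1 ≤ d) (ha : 1 < a)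
    (hG : Finite G) (J : ℤ) (N : ℕ) {h u : EuclideanSpace ℝ (Fin d) → ℂ} (hh : MemLp h 2)
    (hu : MemLp u 2) :
    ∃ k : ℕ, eLpNorm u 2 volume ^ 2 ≤
      8 * energyRemainder (Wav ψ a G J) (N + 1) (h + rescale (scaleMatrix d a k) u) := by
  have ha0 : 0 < a := zero_lt_one.trans ha
  have hB := had.isBessel_fullWav hd ha hG
  set Φ := fullWav ψ a G with hΦ
  set L := eLpNorm u 2 volume ^ 2 with hL
  by_cases hL0 : L = 0
  · exact ⟨0, by rw [hL0]; exact bot_le⟩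
  have hLtop : L ≠ ⊤ := ENNReal.pow_ne_top hu.eLpNorm_ne_top
  obtain ⟨F, hF⟩ : ∃ F : Finset (Fin (N + 1) → ℤ × G), L / 2 <
      ∑ p ∈ F, eLpNorm (propagator (List.ofFn fun n => Φ (p n)) u) 2 volume ^ 2 := by
    have h1 : L / 2 < energyRemainder Φ (N + 1) u := by
      rw [hB.energyRemainder_eq (had.tsum_fullWav hd ha) _ hu]
      exact ENNReal.half_lt_self hL0 hLtop
    rw [energyRemainder, ENNReal.tsum_eq_iSup_sum] at h1
    exact lt_iSup_iff.1 h1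
  -- The responses of `h` to distinct filters are square summable, so those at the shifted first
  -- filters tend to zero.
  have hlim : Tendsto (fun k : ℕ => ∑ p ∈ F,
      2 * eLpNorm (step h (Φ ((p 0).1 + k, (p 0).2))) 2 volume ^ 2) atTop (𝓝 0) := by
    suffices hp : ∀ p ∈ F, Tendsto (fun k : ℕ =>
        2 * eLpNorm (step h (Φ ((p 0).1 + k, (p 0).2))) 2 volume ^ 2) atTop (𝓝 0) by
      simpa using tendsto_finsetSum F hp
    intro p _
    have h1 := ENNReal.tendsto_cofinite_zero_of_tsum_ne_top
      ((hB.tsum_step_le hh).trans_lt (ENNReal.pow_lt_top hh.eLpNorm_lt_top)).ne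
    have hinj : Function.Injective fun k : ℕ => ((p 0).1 + (k : ℤ), (p 0).2) := by
      intro k l hkl
      simpa using hkl
    have h2 := h1.comp hinj.tendsto_cofinite
    rw [Nat.cofinite_eq_atTop] at h2
    simpa using ENNReal.Tendsto.const_mul (a := 2) h2 (Or.inr ENNReal.ofNat_ne_top)
  have hev1 := hlim.eventually_le_const (u := L / 4) (ENNReal.div_pos hL0 ENNReal.ofNat_ne_top)
  have hev2 : ∀ᶠ k : ℕ in atTop, ∀ p ∈ F, ∀ n, -J < (p n).1 + k := by
    rw [eventually_all_finset]
    intro p _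
    rw [eventually_all]
    intro n
    filter_upwards [eventually_gt_atTop (-J - (p n).1).toNat] with k hk
    omega
  obtain ⟨k, hk1, hk2⟩ := (hev1.and hev2).exists
  refine ⟨k, ?_⟩
  set T := rescale (scaleMatrix d a k) u with hT
  have hTm : MemLp T 2 := memLp_rescale (det_scaleMatrix_ne_zero ha0 k) hu
  obtain ⟨s, hs, hw, hsurj⟩ := exists_wav_eq_fullWav (G := G) hd ha J ψ
  have hpath : ∀ p : F, ∃ q : Fin (N + 1) → Lam a G J,
      ∀ n, s (q n) = ((p.1 n).1 + k, (p.1 n).2) := fun p =>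
    Classical.axiomOfChoice fun n => hsurj _ (hk2 p.1 p.2 n)
  choose q hq using hpath
  have hqinj : Function.Injective q := by
    intro p p' hpp
    refine Subtype.ext (funext fun n => ?_)
    have h1 := hq p n
    rw [hpp, hq p' n] at h1
    simp only [Prod.mk.injEq, add_left_inj] at h1
    exact (Prod.ext h1.1 h1.2).symm
  have hW : ∑ p ∈ F, eLpNorm (propagator
      (List.ofFn fun n => Φ ((p n).1 + k, (p n).2)) (h + T)) 2 volume ^ 2 ≤
      energyRemainder (Wav ψ a G J) (N + 1) (h + T) := by
    have h1 := ENNReal.tsum_comp_le_tsum_of_injective hqinj fun p =>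
      eLpNorm (propagator (List.ofFn fun n => Wav ψ a G J (p n)) (h + T)) 2 volume ^ 2
    refine le_trans (le_of_eq ?_) h1
    rw [tsum_fintype, ← Finset.sum_coe_sort]
    refine Finset.sum_congr rfl fun p _ => ?_
    simp only [hw, hq, hΦ]
  have hmain : L / 2 ≤ 2 * energyRemainder (Wav ψ a G J) (N + 1) (h + T) + L / 4 := by
    refine hF.le.trans ?_
    refine le_trans ?_ (add_le_add (mul_le_mul_right hW 2) hk1)
    rw [Finset.mul_sum, ← Finset.sum_add_distrib]
    refine Finset.sum_le_sum fun p _ => ?_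
    rw [← eLpNorm_propagator_rescale_sq ha0 k p u]
    -- Compare `h + T` with `T` along each path: the difference is at most the response of `h` to
    -- the first filter.
    refine (eLpNorm_sq_le_add
      (hB.memLp_propagator (fun n => ((p n).1 + (k : ℤ), (p n).2)) hTm)
      (hB.memLp_propagator (fun n => ((p n).1 + (k : ℤ), (p n).2)) (hh.add hTm))).trans ?_
    refine add_le_add_right (mul_le_mul_right ?_ 2) _
    have := hB.eLpNorm_propagator_sub_le (fun n => ((p n).1 + (k : ℤ), (p n).2)) (hh.add hTm) hTm
    rwa [add_sub_cancel_right] at this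
  have hquarter : L / 2 = L / 4 + L / 4 := by
    rw [← ENNReal.add_div, ← two_mul, show (4 : ℝ≥0∞) = 2 * 2 by norm_num,
      ENNReal.mul_div_mul_left _ _ two_ne_zero ENNReal.ofNat_ne_top]
  rw [hquarter] at hmain
  have h3 : L / 4 ≤ 2 * energyRemainder (Wav ψ a G J) (N + 1) (h + T) :=
    (ENNReal.add_le_add_iff_right (ENNReal.div_ne_top hLtop (by norm_num))).1 hmain
  calc L = 4 * (L / 4) := (ENNReal.mul_div_cancel (by norm_num) (by norm_num)).symm
    _ ≤ 4 * (2 * energyRemainder (Wav ψ a G J) (N + 1) (h + T)) := by gcongr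
    _ = _ := by rw [← mul_assoc]; norm_num

end Wavelet

/-! ### Gliding hump and Baire category for an abstract family `W` -/

section SlowDecay

variable {X : Type*} [NormedAddCommGroup X] {W : ℕ → X → ℝ≥0∞} {E : ℕ → ℝ}

/-- A null sequence has a subsequence, starting at index `1`, which decays geometrically. -/
theorem IsNullSeq.exists_subseq (hE : IsNullSeq E) :
    ∃ ν : ℕ → ℕ, StrictMono ν ∧ ν 0 = 1 ∧ ∀ n, E (ν (n + 1)) ≤ E (ν n) / 64 := by
  -- The guard `1 ≤ m` is needed because `E 0` is arbitrary; the iteration starts at `1`.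
  have hnext : ∀ m : ℕ, ∃ m' : ℕ, m < m' ∧ (1 ≤ m → E m' ≤ E m / 64) := by
    intro m
    by_cases hm : 1 ≤ m
    · have h1 := hE.lim.eventually_le_const (u := E m / 64) (by linarith [hE.pos m hm])
      obtain ⟨m', h2, h3⟩ := (h1.and (eventually_gt_atTop m)).exists
      exact ⟨m', h3, fun _ => h2⟩
    · exact ⟨m + 1, m.lt_succ_self, fun h => (hm h).elim⟩
  choose next hlt hle using hnext
  have hmono : StrictMono fun n => next^[n] 1 := strictMono_nat_of_lt_succ fun n => by
    rw [Function.iterate_succ_apply']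
    exact hlt _
  refine ⟨fun n => next^[n] 1, hmono, rfl, fun n => ?_⟩
  simp only [Function.iterate_succ_apply']
  exact hle _ (hmono.monotone (Nat.zero_le n))

/-- Bump `n` has norm `c n * ‖g‖` and is visible at layer `ν (n + 1)`. All later bumps together are
small against it, so by `hadd` the limit inherits its energy there, and by `hanti` at all earlier
layers. -/
theorem exists_slow_decay [NormedSpace ℝ X] [CompleteSpace X] (hanti : ∀ f, Antitone fun N => W N f)
    (hadd : ∀ N f g, W N f ≤ 2 * W N g + 2 * ENNReal.ofReal (‖g - f‖ ^ 2))
    (hlow : ∀ N (h u : X), 1 ≤ N → ∃ v : X, ‖v‖ = ‖u‖ ∧ ENNReal.ofReal (‖u‖ ^ 2) ≤ 8 * W N (h + v))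
    (g : X) (hE : IsNullSeq E) :
    ∃ f : X, ‖f - g‖ ^ 2 ≤ 6 * ‖g‖ ^ 2 * E 1 ∧
      ∀ N, 1 ≤ N → ENNReal.ofReal (‖g‖ ^ 2 / 8 * E N) ≤ W N f := by
  obtain ⟨ν, hmono, hν0, hνE⟩ := hE.exists_subseq
  have hν1 : ∀ n, 1 ≤ ν n := fun n => hν0 ▸ hmono.monotone (Nat.zero_le n)
  have hEpos : ∀ n, 0 < E (ν n) := fun n => hE.pos _ (hν1 n)
  set c : ℕ → ℝ := fun n => 2 * √(E (ν n)) with hc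
  have hc0 : ∀ n, 0 ≤ c n := fun n => by positivity
  have hcsq : ∀ n, c n ^ 2 = 4 * E (ν n) := fun n => by
    rw [hc, mul_pow, Real.sq_sqrt (hEpos n).le]; norm_num
  -- The ratio `64` for `E` becomes `8` for amplitudes, whence the factor `8 / 7` from the geometric
  -- series below.
  have hcsucc : ∀ n, c (n + 1) ≤ c n / 8 := fun n => by
    refine abs_le_of_sq_le_sq' ?_ (by linarith [hc0 n]) |>.2
    rw [div_pow, hcsq, hcsq]
    linarith [hνE n]
  have hcgeom : ∀ n k, c (n + k) ≤ c n * (1 / 8) ^ k := by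
    intro n k
    induction k with
    | zero => simp
    | succ k ih =>
      rw [pow_succ, ← add_assoc]
      linarith [hcsucc (n + k)]
  -- The index offset is deliberate: for `ν n ≤ N < ν (n + 1)` the target is at most a multiple of
  -- `E (ν n)`, while `W N` dominates `W (ν (n + 1))`.
  choose V hVnorm hVlow using fun n h => hlow (ν (n + 1)) h (c n • g) (hν1 _)
  let h : ℕ → X := fun n => Nat.rec g (fun n x => x + V n x) n
  have hsucc : ∀ n, h (n + 1) = h n + V n (h n) := fun n => rfl
  have hdist : ∀ n k, dist (h (n + k)) (h (n + k + 1)) ≤ c n * ‖g‖ * (1 / 8) ^ k := by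
    intro n k
    rw [hsucc, dist_self_add_right, hVnorm, norm_smul, Real.norm_of_nonneg (hc0 _)]
    calc c (n + k) * ‖g‖ ≤ c n * (1 / 8) ^ k * ‖g‖ := by gcongr; exact hcgeom n k
      _ = _ := by ring
  have hcauchy : CauchySeq h :=
    cauchySeq_of_le_geometric (1 / 8) (c 0 * ‖g‖) (by norm_num) fun k => by
      simpa using hdist 0 k
  obtain ⟨f, hf⟩ := cauchySeq_tendsto_of_complete hcauchy
  have htail : ∀ n, ‖h n - f‖ ≤ 8 / 7 * (c n * ‖g‖) := by
    intro n
    have h1 : Tendsto (fun k => h (n + k)) atTop (𝓝 f) := by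
      simpa only [add_comm n] using (tendsto_add_atTop_iff_nat n).2 hf
    have := dist_le_of_le_geometric_of_tendsto₀ (1 / 8) (c n * ‖g‖) (by norm_num) (hdist n) h1
    rw [add_zero, dist_eq_norm] at this
    refine this.trans (le_of_eq ?_)
    ring
  have htail_sq : ∀ n, ‖h n - f‖ ^ 2 ≤ 6 * ‖g‖ ^ 2 * E (ν n) := by
    intro n
    calc ‖h n - f‖ ^ 2 ≤ (8 / 7 * (c n * ‖g‖)) ^ 2 := by gcongr; exact htail n
      _ = 256 / 49 * (‖g‖ ^ 2 * E (ν n)) := by rw [mul_pow, mul_pow, hcsq]; ring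
      _ ≤ _ := by
        have : 0 ≤ ‖g‖ ^ 2 * E (ν n) := mul_nonneg (sq_nonneg _) (hEpos n).le
        linarith
  refine ⟨f, ?_, fun N hN => ?_⟩
  · rw [norm_sub_rev, ← hν0]
    exact htail_sq 0
  have hex : ∃ n, N < ν n := ⟨N + 1, hmono.le_apply⟩
  obtain ⟨n, hn⟩ : ∃ n, Nat.find hex = n + 1 :=
    Nat.exists_eq_succ_of_ne_zero fun h0 => by
      have := Nat.find_spec hex
      rw [h0, hν0] at this
      omega
  have hN1 : N < ν (n + 1) := hn ▸ Nat.find_spec hex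
  have hN2 : ν n ≤ N := not_lt.1 (Nat.find_min hex (by omega))
  refine le_trans ?_ (hanti f hN1.le)
  by_cases htop : W (ν (n + 1)) f = ⊤
  · simp only [htop, le_top]
  have h1 : ENNReal.ofReal (‖c n • g‖ ^ 2) ≤
      8 * (2 * W (ν (n + 1)) f + 2 * ENNReal.ofReal (‖f - h (n + 1)‖ ^ 2)) := by
    refine (hVlow n (h n)).trans ?_
    rw [← hsucc]
    gcongr
    exact hadd _ _ _
  set w := (W (ν (n + 1)) f).toReal with hw
  have hw0 : 0 ≤ w := ENNReal.toReal_nonneg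
  have hWw : W (ν (n + 1)) f = ENNReal.ofReal w := (ENNReal.ofReal_toReal htop).symm
  have h2 : ‖c n • g‖ ^ 2 ≤ 8 * (2 * w + 2 * ‖f - h (n + 1)‖ ^ 2) := by
    rw [hWw] at h1
    rw [← ENNReal.ofReal_le_ofReal_iff (by positivity), ENNReal.ofReal_mul (by norm_num),
      ENNReal.ofReal_add (by positivity) (by positivity), ENNReal.ofReal_mul (by norm_num),
      ENNReal.ofReal_mul (by norm_num)]
    simpa using h1
  have h3 := htail_sq (n + 1)
  rw [norm_sub_rev] at h3
  rw [norm_smul, Real.norm_of_nonneg (hc0 n), mul_pow, hcsq] at h2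
  have hg := sq_nonneg ‖g‖
  have h4 := mul_le_mul_of_nonneg_left (hνE n) hg
  have h5 := mul_le_mul_of_nonneg_left (hE.anti _ _ (hν1 n) hN2) hg
  have h6 := mul_nonneg hg (hEpos n).le
  simp only [hWw]
  -- With `e = ‖g‖ ^ 2 * E (ν n)` the bounds give `4 * e ≤ 16 * w + 96 * e / 64`, so `w ≥ 5 * e /
  -- 32`, which exceeds the required `e / 8`.
  exact ENNReal.ofReal_le_ofReal (by nlinarith)

theorem closure_le_subset
    (hadd : ∀ N f g, W N f ≤ 2 * W N g + 2 * ENNReal.ofReal (‖g - f‖ ^ 2)) (b : ℕ → ℝ)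
    (N₀ : ℕ) :
    closure {f | ∀ N, N₀ ≤ N → W N f ≤ ENNReal.ofReal (b N)} ⊆
      {f | ∀ N, N₀ ≤ N → W N f ≤ 2 * ENNReal.ofReal (b N)} := by
  intro f hf N hN
  obtain ⟨u, hu, hlim⟩ := mem_closure_iff_seq_limit.1 hf
  have h1 : Tendsto (fun n => 2 * ENNReal.ofReal (b N) + 2 * ENNReal.ofReal (‖u n - f‖ ^ 2)) atTop
      (𝓝 (2 * ENNReal.ofReal (b N))) := by
    have h2 := ((tendsto_iff_norm_sub_tendsto_zero.1 hlim).pow 2)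
    rw [zero_pow two_ne_zero] at h2
    have h3 := ENNReal.tendsto_ofReal h2
    rw [ENNReal.ofReal_zero] at h3
    simpa using (ENNReal.Tendsto.const_mul (a := 2) h3 (Or.inr ENNReal.ofNat_ne_top)).const_add
      (2 * ENNReal.ofReal (b N))
  refine ge_of_tendsto' h1 fun n => (hadd N f (u n)).trans ?_
  gcongr
  exact hu n N hN

theorem IsNullSeq.const_mul_sqrt (hE : IsNullSeq E) {t : ℝ} (ht : 0 < t) :
    IsNullSeq fun N => t * √(E N) where
  pos N hN := mul_pos ht (Real.sqrt_pos.2 (hE.pos N hN))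
  anti M N hM hMN :=
    mul_le_mul_of_nonneg_left (Real.sqrt_le_sqrt (hE.anti M N hM hMN)) ht.le
  lim := by
    have := (Real.continuous_sqrt.tendsto 0).comp hE.lim
    rw [Real.sqrt_zero] at this
    simpa using this.const_mul t

/-- Inside a ball in the closure, slow decay is realized for the rate `t * √(E N)`, which is
eventually larger than any multiple of `E N`. The closure costs only a factor `2` in the upper
bound, so the two rates contradict each other. -/
theorem isNowhereDense_fast_decay [NormedSpace ℝ X] [Nontrivial X]
    (hadd : ∀ N f g, W N f ≤ 2 * W N g + 2 * ENNReal.ofReal (‖g - f‖ ^ 2))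
    (hslow : ∀ g : X, ∃ C : ℝ, ∀ E : ℕ → ℝ, IsNullSeq E → ∃ f : X,
      ‖f - g‖ ^ 2 ≤ C * E 1 ∧ ∀ N, 1 ≤ N → ENNReal.ofReal (‖g‖ ^ 2 / 8 * E N) ≤ W N f)
    (hE : IsNullSeq E) {C : ℝ} (hC : 0 ≤ C) (N₀ : ℕ) :
    IsNowhereDense {f | ∀ N, N₀ ≤ N → W N f ≤ ENNReal.ofReal (C * E N)} := by
  rw [IsNowhereDense, Set.eq_empty_iff_forall_notMem]
  intro g₀ hg₀
  -- The centre must be nonzero, since the lower bound is proportional to `‖g‖ ^ 2`; a small `t`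
  -- then keeps `f` in the ball.
  obtain ⟨g, hgU, hg0⟩ := (dense_compl_singleton (0 : X)).inter_open_nonempty _ isOpen_interior
    ⟨g₀, hg₀⟩
  obtain ⟨r, hr, hball⟩ := Metric.isOpen_iff.1 isOpen_interior g hgU
  obtain ⟨D, hD⟩ := hslow g
  have hg : 0 < ‖g‖ := norm_pos_iff.2 hg0
  obtain ⟨t, ht, htr⟩ : ∃ t : ℝ, 0 < t ∧ D * (t * √(E 1)) < r ^ 2 := by
    have hlim : Tendsto (fun t : ℝ => D * (t * √(E 1))) (𝓝[>] 0) (𝓝 0) := by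
      have : Continuous fun t : ℝ => D * (t * √(E 1)) := by fun_prop
      simpa using (this.tendsto 0).mono_left nhdsWithin_le_nhds
    obtain ⟨t, h1, h2⟩ := ((hlim.eventually_lt_const (pow_pos hr 2)).and self_mem_nhdsWithin).exists
    exact ⟨t, h2, h1⟩
  obtain ⟨f, hfg, hf⟩ := hD _ (hE.const_mul_sqrt ht)
  have hfr : f ∈ Metric.ball g r := by
    rw [mem_ball_iff_norm]
    exact lt_of_pow_lt_pow_left₀ 2 hr.le (hfg.trans_lt htr)
  have hfC := closure_le_subset hadd _ _ (interior_subset (hball hfr))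
  have hbound : ∀ N, max 1 N₀ ≤ N → ‖g‖ ^ 2 / 8 * t ≤ 2 * C * √(E N) := by
    intro N hN
    have hE0 := hE.pos N (le_of_max_le_left hN)
    have h1 := (hf N (le_of_max_le_left hN)).trans (hfC N (le_of_max_le_right hN))
    have h2 : (2 : ℝ≥0∞) = ENNReal.ofReal 2 := by simp
    rw [h2, ← ENNReal.ofReal_mul zero_le_two, ENNReal.ofReal_le_ofReal_iff (by positivity)] at h1
    have h3 : 0 < √(E N) := Real.sqrt_pos.2 hE0
    refine le_of_mul_le_mul_right ?_ h3
    calc ‖g‖ ^ 2 / 8 * t * √(E N) = ‖g‖ ^ 2 / 8 * (t * √(E N)) := by ring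
      _ ≤ 2 * (C * E N) := h1
      _ = 2 * C * √(E N) * √(E N) := by rw [mul_assoc _ √(E N), Real.mul_self_sqrt hE0.le]; ring
  have hlim : Tendsto (fun N => 2 * C * √(E N)) atTop (𝓝 0) := by
    have := (Real.continuous_sqrt.tendsto 0).comp hE.lim
    rw [Real.sqrt_zero] at this
    simpa using this.const_mul (2 * C)
  have := ge_of_tendsto hlim ((eventually_ge_atTop (max 1 N₀)).mono hbound)
  have hpos : 0 < ‖g‖ ^ 2 / 8 * t := by positivity
  linarith

theorem isMeagre_fast_decay [NormedSpace ℝ X] [Nontrivial X]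
    (hadd : ∀ N f g, W N f ≤ 2 * W N g + 2 * ENNReal.ofReal (‖g - f‖ ^ 2))
    (hslow : ∀ g : X, ∃ C : ℝ, ∀ E : ℕ → ℝ, IsNullSeq E → ∃ f : X,
      ‖f - g‖ ^ 2 ≤ C * E 1 ∧ ∀ N, 1 ≤ N → ENNReal.ofReal (‖g‖ ^ 2 / 8 * E N) ≤ W N f)
    (hE : IsNullSeq E) :
    IsMeagre {f : X | ∃ C : ℝ, 0 < C ∧ ∃ N₀ : ℕ, 1 ≤ N₀ ∧ ∀ N, N₀ ≤ N →
      W N f ≤ ENNReal.ofReal (C * E N)} := by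
  refine IsMeagre.mono (s := ⋃ m : ℕ × ℕ,
    {f | ∀ N, m.2 ≤ N → W N f ≤ ENNReal.ofReal ((m.1 : ℝ) * E N)}) ?_ ?_
  · rintro f ⟨C, -, N₀, hN₀, hf⟩
    obtain ⟨m, hm⟩ := exists_nat_ge C
    refine Set.mem_iUnion.2 ⟨(m, N₀), fun N hN => (hf N hN).trans ?_⟩
    exact ENNReal.ofReal_le_ofReal
      (mul_le_mul_of_nonneg_right hm (hE.pos N (hN₀.trans hN)).le)
  · exact isMeagre_iUnion fun m =>
      (isNowhereDense_fast_decay hadd hslow hE m.1.cast_nonneg m.2).isMeagre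

end SlowDecay

/-! ### Transfer to `L²` classes -/

section LTwo

variable {d : ℕ}

theorem ofReal_norm_sq (f : L2 d) : ENNReal.ofReal (‖f‖ ^ 2) = eLpNorm f 2 volume ^ 2 := by
  rw [ENNReal.ofReal_pow (norm_nonneg _), ofReal_norm, Lp.enorm_def]

theorem nontrivial_L2 (d : ℕ) : Nontrivial (L2 d) := by
  set s : Set (EuclideanSpace ℝ (Fin d)) := Metric.ball 0 1
  have hs : volume s ≠ ⊤ := measure_ball_lt_top.ne
  refine ⟨indicatorConstLp 2 measurableSet_ball hs (1 : ℂ), 0, fun h => ?_⟩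
  have h1 := congrArg norm h
  rw [norm_zero, norm_indicatorConstLp two_ne_zero ENNReal.ofNat_ne_top, norm_one, one_mul,
    Real.rpow_eq_zero_iff_of_nonneg measureReal_nonneg] at h1
  exact (Metric.measure_ball_pos volume (0 : EuclideanSpace ℝ (Fin d)) one_pos).ne'
    (((ENNReal.toReal_eq_zero_iff _).1 h1.1).resolve_right hs)

variable {a : ℝ} {G : Subgroup (Matrix.orthogonalGroup (Fin d) ℝ)}
  {ψ φ : EuclideanSpace ℝ (Fin d) → ℂ}

theorem IsBessel.energyRemainder_coe_le_add {ι : Type*}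
    {Ψ : ι → EuclideanSpace ℝ (Fin d) → ℂ} (h : IsBessel Ψ) (N : ℕ) (f g : L2 d) :
    energyRemainder Ψ N f ≤
      2 * energyRemainder Ψ N g + 2 * ENNReal.ofReal (‖g - f‖ ^ 2) := by
  rw [ofReal_norm_sq, eLpNorm_congr_ae (Lp.coeFn_sub g f)]
  exact h.energyRemainder_le_add N (Lp.memLp f) (Lp.memLp g)

theorem Admissible.exists_norm_eq (had : Admissible a G ψ φ) (hd : 1 ≤ d) (ha : 1 < a)
    (hG : Finite G) (J : ℤ) (N : ℕ) (h u : L2 d) (hN : 1 ≤ N) :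
    ∃ v : L2 d, ‖v‖ = ‖u‖ ∧
      ENNReal.ofReal (‖u‖ ^ 2) ≤ 8 * energyRemainder (Wav ψ a G J) N (h + v : L2 d) := by
  obtain ⟨N, rfl⟩ := Nat.exists_eq_add_of_le' hN
  obtain ⟨k, hk⟩ := had.exists_rescale hd ha hG J N (Lp.memLp h) (Lp.memLp u)
  have hdet := det_scaleMatrix_ne_zero (d := d) (zero_lt_one.trans ha) k
  have hv := memLp_rescale hdet (Lp.memLp u)
  refine ⟨hv.toLp _, ?_, ?_⟩
  · have h1 : ENNReal.ofReal (‖hv.toLp _‖ ^ 2) = ENNReal.ofReal (‖u‖ ^ 2) := by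
      rw [ofReal_norm_sq, ofReal_norm_sq, eLpNorm_congr_ae hv.coeFn_toLp, eLpNorm_rescale_sq hdet]
    rw [ENNReal.ofReal_eq_ofReal_iff (sq_nonneg _) (sq_nonneg _)] at h1
    exact (sq_eq_sq₀ (norm_nonneg _) (norm_nonneg _)).1 h1
  · rw [ofReal_norm_sq]
    refine hk.trans (le_of_eq ?_)
    congr 1
    refine energyRemainder_congr_ae _ _ ?_
    filter_upwards [Lp.coeFn_add h (hv.toLp _), hv.coeFn_toLp] with x h1 h2
    rw [h1, Pi.add_apply, Pi.add_apply, h2]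

theorem Admissible.exists_slow (had : Admissible a G ψ φ) (hd : 1 ≤ d) (ha : 1 < a)
    (hG : Finite G) (J : ℤ) (g : L2 d) {E : ℕ → ℝ} (hE : IsNullSeq E) :
    ∃ f : L2 d, ‖f - g‖ ^ 2 ≤ 6 * ‖g‖ ^ 2 * E 1 ∧
      ∀ N, 1 ≤ N →
        ENNReal.ofReal (‖g‖ ^ 2 / 8 * E N) ≤ energyRemainder (Wav ψ a G J) N f :=
  have hB := had.isBessel_wav hd ha hG J
  exists_slow_decay (W := fun N (f : L2 d) => energyRemainder (Wav ψ a G J) N f)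
    (fun f => hB.antitone_energyRemainder (Lp.memLp f)) hB.energyRemainder_coe_le_add
    (had.exists_norm_eq hd ha hG J) g hE

end LTwo

end Scattering

theorem mainTheorem2 (d : ℕ) (hd : 1 ≤ d) (a : ℝ) (ha : 1 < a)
    (G : Subgroup (Matrix.orthogonalGroup (Fin d) ℝ)) (hG : Finite G) (hneg : -1 ∈ G)
    (J : ℤ) (ψ φ : EuclideanSpace ℝ (Fin d) → ℂ) (hψφ : Scattering.Admissible a G ψ φ) :
    (∀ g : Scattering.L2 d, ∃ C : ℝ, 0 < C ∧
      ∀ E : ℕ → ℝ, Scattering.IsNullSeq E →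
        ∃ f : Scattering.L2 d,
          ‖f‖ ^ 2 ≤ C * (1 + E 1) ∧
          ‖f - g‖ ^ 2 ≤ C * E 1 ∧
          ∀ N : ℕ, 1 ≤ N →
            ENNReal.ofReal (‖g‖ ^ 2 / 8 * E N) ≤
              Scattering.energyRemainder (Scattering.Wav ψ a G J) N f) ∧
    (∀ E : ℕ → ℝ, Scattering.IsNullSeq E →
      IsMeagre (Scattering.fastDecay (Scattering.Wav ψ a G J) E) ∧
      Dense (Scattering.fastDecay (Scattering.Wav ψ a G J) E)ᶜ) := by
  -- The `12` comes from `‖f‖ ^ 2 ≤ 2 * ‖g‖ ^ 2 + 2 * ‖f - g‖ ^ 2` and the constant `6`; the `+ 1`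
  -- keeps it positive when `g = 0`.
  refine ⟨fun g => ⟨12 * ‖g‖ ^ 2 + 1, by positivity, fun E hE => ?_⟩, fun E hE => ?_⟩
  · obtain ⟨f, hfg, hf⟩ := hψφ.exists_slow hd ha hG J g hE
    have hE1 := hE.pos 1 le_rfl
    have hg := sq_nonneg ‖g‖
    have hgE := mul_nonneg hg hE1.le
    refine ⟨f, ?_, by nlinarith, hf⟩
    have h1 : ‖f‖ ≤ ‖g‖ + ‖f - g‖ := by simpa using norm_add_le g (f - g)
    have h2 : ‖f‖ ^ 2 ≤ (‖g‖ + ‖f - g‖) ^ 2 := by gcongr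
    nlinarith [sq_nonneg (‖g‖ - ‖f - g‖)]
  · have := Scattering.nontrivial_L2 d
    have hM : IsMeagre (Scattering.fastDecay (Scattering.Wav ψ a G J) E) :=
      Scattering.isMeagre_fast_decay
        (W := fun N (f : Scattering.L2 d) =>
          Scattering.energyRemainder (Scattering.Wav ψ a G J) N f)
        (hψφ.isBessel_wav hd ha hG J).energyRemainder_coe_le_add
        (fun g => ⟨6 * ‖g‖ ^ 2, fun E' hE' => hψφ.exists_slow hd ha hG J g hE'⟩) hE
    exact ⟨hM, dense_of_mem_residual hM⟩
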